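/- Let $\mathcal{M}_{\mathbb{Q}}$ be the commutative ring whose elements $[r]$ are the ratios $r=f/g\in\mathbb{Q}(x)$ of monic polynomials $f,g\in\mathbb{Q}[x]$, whose addition is multiplication of rational functions, and whose multiplication is the biadditive extension of $$\Big[\prod_i (x-\alpha_i)\Big]\cdot\Big[\prod_j (x-\beta_j)\Big]=\Big[\prod_{i,j}(x-\alpha_i\beta_j)\Big],$$ the roots being taken with multiplicity in an algebraic closure of $\mathbb{Q}$ (so $0=[1]$ and the unit is $[x-1]$). For an integer $k\ge 0$ let $t_k:\mathcal{M}_{\mathbb{Q}}\to\mathbb{Q}$ be the additive map $$t_k\Big(\Big[\prod_i (x-\alpha_i)\Big/\prod_j(x-\beta_j)\Big]\Big)=\sum_i\alpha_i^k-\sum_j\beta_j^k\qquad(0^0=1),$$ and give $\mathcal{M}_{\mathbb{Q}}$ the topology induced by the injection $(t_k)_{k\ge 0}:\mathcal{M}_{\mathbb{Q}}\hookrightarrow\prod_{k\ge 0}\mathbb{Q}$, where $\mathbb{Q}$ is discrete and the product has the product topology. For $k\ge 1$ let $\lambda_k:\mathcal{M}_{\mathbb{Q}}\to\mathcal{M}_{\mathbb{Q}}$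 be the map $$\Big[\prod_i (x-\alpha_i)\Big/\prod_j(x-\beta_j)\Big]\mapsto\Big[\prod_i (x-\alpha_i^k)\Big/\prod_j(x-\beta_j^k)\Big].$$ **Theorem (Endomorphism Classification Theorem).** Let $\varphi:\mathcal{M}_{\mathbb{Q}}\to\mathcal{M}_{\mathbb{Q}}$ be a continuous (unital) ring endomorphism. Then at least one of the following holds. 1. There are integers $k\ge 1$ and $j\ge 0$ such that $\varphi=\lambda_k+(t_j-t_0)[x]$; that is, for every $r\in\mathcal{M}_{\mathbb{Q}}$ the number $t_j(r)-t_0(r)$ is an integer and $\varphi(r)=\lambda_k(r)+\big(t_j(r)-t_0(r)\big)\cdot[x]$. 2. $\varphi\big([1-x^{-n}]\big)=0$ for all but finitely many integers $n\ge 1$. -/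

import Mathlib

open Polynomial

open scoped RatFunc

/-- The monic polynomial `∏ (X - a)`, `a` running over a finite multiset `s` of elements of the
algebraic closure, has coefficients in `K` when `s` is invariant under the Galois group. -/
theorem exists_monic_of_invariant {K : Type*} [Field K] [CharZero K]
    (s : Multiset (AlgebraicClosure K))
    (hs : ∀ σ : AlgebraicClosure K ≃ₐ[K] AlgebraicClosure K, s.map σ = s) :
    ∃ p : K[X], p.Monic ∧
      p.map (algebraMap K (AlgebraicClosure K)) = (s.map fun a => X - C a).prod := by
  have hlift : (s.map fun a => X - C a).prod ∈ lifts (algebraMap K (AlgebraicClosure K)) := by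
    rw [lifts_iff_coeff_lifts]
    intro n
    rw [InfiniteGalois.mem_range_algebraMap_iff_fixed]
    intro σ
    have h : ((s.map fun a => X - C a).prod).map (σ : AlgebraicClosure K →+* AlgebraicClosure K)
        = (s.map fun a => X - C a).prod := by
      conv_rhs => rw [← hs σ]
      rw [Polynomial.map_multiset_prod, Multiset.map_map, Multiset.map_map]
      congr 1
      apply Multiset.map_congr rfl
      intro a _
      simp
    conv_rhs => rw [← h]
    rw [coeff_map]
    rfl
  obtain ⟨q, h1, -, h2⟩ := lifts_and_natDegree_eq_and_monic hlift
    (monic_multiset_prod_of_monic _ _ fun a _ => monic_X_sub_C a)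
  exact ⟨q, h2, h1⟩

theorem aroots_map_algEquiv {K : Type*} [Field K] (f : K[X])
    (σ : AlgebraicClosure K ≃ₐ[K] AlgebraicClosure K) :
    (f.aroots (AlgebraicClosure K)).map σ = f.aroots (AlgebraicClosure K) := by
  have h := (IsAlgClosed.splits (f.map (algebraMap K (AlgebraicClosure K)))).roots_map_of_injective
    (i := (σ : AlgebraicClosure K →+* AlgebraicClosure K)) σ.injective
  rw [Polynomial.map_map] at h
  have h2 : ((σ : AlgebraicClosure K →+* AlgebraicClosure K)).comp
      (algebraMap K (AlgebraicClosure K)) = algebraMap K (AlgebraicClosure K) := by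
    ext x; simp
  rw [h2] at h
  exact h.symm

theorem exists_composedProd {K : Type*} [Field K] [CharZero K] (f g : K[X]) :
    ∃ p : K[X], p.Monic ∧ p.map (algebraMap K (AlgebraicClosure K)) =
      (((f.aroots (AlgebraicClosure K) ×ˢ g.aroots (AlgebraicClosure K)).map
        fun ab => ab.1 * ab.2).map fun a => X - C a).prod := by
  apply exists_monic_of_invariant
  intro σ
  conv_rhs => rw [← aroots_map_algEquiv f σ, ← aroots_map_algEquiv g σ]
  simp only [SProd.sprod, Multiset.product, Multiset.map_bind, Multiset.bind_map,
    Multiset.map_map, Function.comp_def, map_mul]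

theorem exists_rootPow {K : Type*} [Field K] [CharZero K] (k : ℕ) (f : K[X]) :
    ∃ p : K[X], p.Monic ∧ p.map (algebraMap K (AlgebraicClosure K)) =
      (((f.aroots (AlgebraicClosure K)).map fun a => a ^ k).map fun a => X - C a).prod := by
  apply exists_monic_of_invariant
  intro σ
  conv_rhs => rw [← aroots_map_algEquiv f σ]
  simp only [Multiset.map_map, Function.comp_def, map_pow]

theorem exists_powerSum {K : Type*} [Field K] [CharZero K] (k : ℕ) (f : K[X]) :
    ∃ a : K, algebraMap K (AlgebraicClosure K) a =
      ((f.aroots (AlgebraicClosure K)).map fun a => a ^ k).sum := by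
  rw [← Set.mem_range, InfiniteGalois.mem_range_algebraMap_iff_fixed]
  intro σ
  conv_rhs => rw [← aroots_map_algEquiv f σ]
  rw [map_multiset_sum, Multiset.map_map, Multiset.map_map]
  simp only [Function.comp_def, map_pow]

/-- `∏_{i,j} (X - αᵢ βⱼ)`, where the `αᵢ` and the `βⱼ` are the roots (with multiplicity, in an
algebraic closure of `K`) of `f` and of `g`. -/
noncomputable def composedProd {K : Type*} [Field K] [CharZero K] (f g : K[X]) : K[X] :=
  (exists_composedProd f g).choose

/-- `∏_i (X - αᵢ ^ k)`, where the `αᵢ` are the roots of `f` (with multiplicity). -/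
noncomputable def rootPow {K : Type*} [Field K] [CharZero K] (k : ℕ) (f : K[X]) : K[X] :=
  (exists_rootPow k f).choose

/-- `∑_i αᵢ ^ k`, where the `αᵢ` are the roots of `f` (with multiplicity); `0 ^ 0 = 1`. -/
noncomputable def powerSum {K : Type*} [Field K] [CharZero K] (k : ℕ) (f : K[X]) : K :=
  (exists_powerSum k f).choose

theorem monic_composedProd {K : Type*} [Field K] [CharZero K] (f g : K[X]) :
    (composedProd f g).Monic := (exists_composedProd f g).choose_spec.1

theorem aroots_composedProd {K : Type*} [Field K] [CharZero K] (f g : K[X]) :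
    (composedProd f g).aroots (AlgebraicClosure K) =
      (f.aroots (AlgebraicClosure K) ×ˢ g.aroots (AlgebraicClosure K)).map
        fun ab => ab.1 * ab.2 := by
  rw [aroots_def, composedProd, (exists_composedProd f g).choose_spec.2,
    roots_multiset_prod_X_sub_C]

theorem monic_rootPow {K : Type*} [Field K] [CharZero K] (k : ℕ) (f : K[X]) :
    (rootPow k f).Monic := (exists_rootPow k f).choose_spec.1

/-- The set `𝓜_K` of all ratios of monic polynomials in `K(x)`. -/
@[ext]
structure MonicRatio (K : Type*) [Field K] where
  toRatFunc : K⟮X⟯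
  isRatio : ∃ f g : K[X], f.Monic ∧ g.Monic ∧
    toRatFunc = algebraMap K[X] K⟮X⟯ f / algebraMap K[X] K⟮X⟯ g

namespace MonicRatio

/-- The element `[f / g]`. -/
noncomputable def mk' {K : Type*} [Field K] (f g : K[X]) (hf : f.Monic) (hg : g.Monic) :
    MonicRatio K :=
  ⟨algebraMap K[X] K⟮X⟯ f / algebraMap K[X] K⟮X⟯ g, f, g, hf, hg, rfl⟩

/-- The numerator of `r` in lowest terms. -/
noncomputable def num {K : Type*} [Field K] (r : MonicRatio K) : K[X] := r.toRatFunc.num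

/-- The (monic) denominator of `r` in lowest terms. -/
noncomputable def denom {K : Type*} [Field K] (r : MonicRatio K) : K[X] := r.toRatFunc.denom

theorem monic_denom {K : Type*} [Field K] (r : MonicRatio K) : r.denom.Monic :=
  RatFunc.monic_denom _

theorem num_mul_eq {K : Type*} [Field K] (f g : K[X]) (hf : f.Monic) (hg : g.Monic) :
    (mk' f g hf hg).num * g = f * (mk' f g hf hg).denom :=
  (RatFunc.num_mul_eq_mul_denom_iff hg.ne_zero).2 rfl

theorem mk'_num_denom {K : Type*} [Field K] (r : MonicRatio K) :
    r.toRatFunc = algebraMap K[X] K⟮X⟯ r.num / algebraMap K[X] K⟮X⟯ r.denom :=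
  (RatFunc.num_div_denom _).symm

theorem exists_mk' {K : Type*} [Field K] (r : MonicRatio K) :
    ∃ f g hf hg, r = mk' f g hf hg := by
  obtain ⟨x, f, g, hf, hg, rfl⟩ := r
  exact ⟨f, g, hf, hg, rfl⟩

theorem monic_num {K : Type*} [Field K] (r : MonicRatio K) : r.num.Monic := by
  obtain ⟨f, g, hf, hg, rfl⟩ := r.exists_mk'
  have h := congrArg leadingCoeff (num_mul_eq f g hf hg)
  rw [leadingCoeff_mul, leadingCoeff_mul, hf.leadingCoeff, hg.leadingCoeff,
    (monic_denom _).leadingCoeff, mul_one, mul_one] at h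
  exact h

/-- The zero of `𝓜_K` is the rational function `1`. -/
noncomputable instance {K : Type*} [Field K] : Zero (MonicRatio K) :=
  ⟨⟨1, 1, 1, monic_one, monic_one, by simp⟩⟩

/-- The addition of `𝓜_K` is the multiplication of rational functions. -/
noncomputable instance {K : Type*} [Field K] : Add (MonicRatio K) :=
  ⟨fun r s => ⟨r.toRatFunc * s.toRatFunc, by
    obtain ⟨f, g, hf, hg, h⟩ := r.isRatio
    obtain ⟨f', g', hf', hg', h'⟩ := s.isRatio
    exact ⟨f * f', g * g', hf.mul hf', hg.mul hg', by
      rw [h, h', map_mul, map_mul, div_mul_div_comm]⟩⟩⟩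

/-- The negation of `𝓜_K` is the inversion of rational functions. -/
noncomputable instance {K : Type*} [Field K] : Neg (MonicRatio K) :=
  ⟨fun r => ⟨r.toRatFunc⁻¹, by
    obtain ⟨f, g, hf, hg, h⟩ := r.isRatio
    exact ⟨g, f, hg, hf, by rw [h, inv_div]⟩⟩⟩

/-- The unit of `𝓜_K` is `[x - 1]`. -/
noncomputable instance {K : Type*} [Field K] : One (MonicRatio K) :=
  ⟨mk' (X - C 1) 1 (monic_X_sub_C 1) monic_one⟩

/-- The multiplication of `𝓜_K`: the biadditive extension of
`[∏ (x - αᵢ)] · [∏ (x - βⱼ)] = [∏ (x - αᵢ βⱼ)]` to ratios of monic polynomials. -/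
noncomputable instance {K : Type*} [Field K] [CharZero K] : Mul (MonicRatio K) :=
  ⟨fun r s => mk'
    (composedProd r.num s.num * composedProd r.denom s.denom)
    (composedProd r.num s.denom * composedProd r.denom s.num)
    ((monic_composedProd _ _).mul (monic_composedProd _ _))
    ((monic_composedProd _ _).mul (monic_composedProd _ _))⟩

/-- The divisor `∑ [αᵢ]` of the roots of a polynomial, in the monoid ring of the
multiplicative monoid of the algebraic closure. -/
noncomputable def polyDiv {K : Type*} [Field K] (f : K[X]) :
    MonoidAlgebra ℤ (AlgebraicClosure K) :=
  ((f.aroots (AlgebraicClosure K)).map fun a => MonoidAlgebra.of ℤ _ a).sum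

theorem polyDiv_mul {K : Type*} [Field K] {f g : K[X]} (hf : f.Monic) (hg : g.Monic) :
    polyDiv (f * g) = polyDiv f + polyDiv g := by
  rw [polyDiv, aroots_mul (mul_ne_zero hf.ne_zero hg.ne_zero), Multiset.map_add, Multiset.sum_add]
  rfl

theorem polyDiv_composedProd {K : Type*} [Field K] [CharZero K] (f g : K[X]) :
    polyDiv (composedProd f g) = polyDiv f * polyDiv g := by
  simp only [polyDiv, aroots_composedProd, SProd.sprod, Multiset.product, Multiset.map_bind,
    Multiset.map_map, Function.comp_def, map_mul, Multiset.sum_bind, Multiset.sum_map_mul_left,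
    Multiset.sum_map_mul_right]

theorem polyDiv_injective {K : Type*} [Field K] {f g : K[X]} (hf : f.Monic) (hg : g.Monic)
    (h : polyDiv f = polyDiv g) : f = g := by
  classical
  have key : ∀ (s : Multiset (AlgebraicClosure K)) (a : AlgebraicClosure K),
      ((s.map fun a => MonoidAlgebra.of ℤ (AlgebraicClosure K) a).sum).coeff a
        = (s.count a : ℤ) := by
    intro s a
    induction s using Multiset.induction_on with
    | empty => simp
    | cons b s ih =>
      rw [Multiset.map_cons, Multiset.sum_cons, Multiset.count_cons, MonoidAlgebra.coeff_add,
        Finsupp.add_apply, ih, MonoidAlgebra.of_apply, MonoidAlgebra.coeff_single,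
        Finsupp.single_apply]
      by_cases hab : a = b
      · simp [hab, add_comm]
      · simp [hab, Ne.symm hab]
  have hroots : f.aroots (AlgebraicClosure K) = g.aroots (AlgebraicClosure K) := by
    ext a
    have h1 := key (f.aroots (AlgebraicClosure K)) a
    have h2 := key (g.aroots (AlgebraicClosure K)) a
    have h3 := congrArg (fun z : MonoidAlgebra ℤ (AlgebraicClosure K) => z.coeff a) h
    simp only [polyDiv] at h3
    rw [h1, h2] at h3
    exact_mod_cast h3
  apply map_injective (algebraMap K (AlgebraicClosure K)) (algebraMap K _).injective
  rw [(IsAlgClosed.splits (f.map (algebraMap K (AlgebraicClosure K)))).eq_prod_roots_of_monic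
      (hf.map _),
    (IsAlgClosed.splits (g.map (algebraMap K (AlgebraicClosure K)))).eq_prod_roots_of_monic
      (hg.map _)]
  exact congrArg (fun s : Multiset (AlgebraicClosure K) => (s.map fun a => X - C a).prod) hroots

/-- The divisor of a ratio of monic polynomials; it identifies `𝓜_K` with a subring of the monoid
ring, from which the ring axioms are inherited. -/
noncomputable def divisor {K : Type*} [Field K] (r : MonicRatio K) :
    MonoidAlgebra ℤ (AlgebraicClosure K) :=
  polyDiv r.num - polyDiv r.denom

theorem divisor_of_eq {K : Type*} [Field K] {r : MonicRatio K} {f g : K[X]} (hf : f.Monic)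
    (hg : g.Monic) (h : r.toRatFunc = algebraMap K[X] K⟮X⟯ f / algebraMap K[X] K⟮X⟯ g) :
    r.divisor = polyDiv f - polyDiv g := by
  have hr : r = mk' f g hf hg := MonicRatio.ext h
  have h1 := congrArg polyDiv (num_mul_eq f g hf hg)
  rw [← hr, polyDiv_mul r.monic_num hg, polyDiv_mul hf r.monic_denom] at h1
  rw [divisor, sub_eq_sub_iff_add_eq_add, h1]

theorem divisor_injective {K : Type*} [Field K] :
    Function.Injective (divisor : MonicRatio K → MonoidAlgebra ℤ (AlgebraicClosure K)) := by
  intro r s h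
  rw [divisor, divisor, sub_eq_sub_iff_add_eq_add, ← polyDiv_mul r.monic_num s.monic_denom,
    ← polyDiv_mul s.monic_num r.monic_denom] at h
  have h1 := polyDiv_injective (r.monic_num.mul s.monic_denom) (s.monic_num.mul r.monic_denom) h
  apply MonicRatio.ext
  rw [mk'_num_denom r, mk'_num_denom s, div_eq_div_iff
    (RatFunc.algebraMap_ne_zero r.monic_denom.ne_zero)
    (RatFunc.algebraMap_ne_zero s.monic_denom.ne_zero), ← map_mul, ← map_mul, h1]

theorem divisor_zero {K : Type*} [Field K] : (0 : MonicRatio K).divisor = 0 := by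
  rw [divisor_of_eq (r := 0) monic_one monic_one (show (1 : K⟮X⟯) = _ by simp), sub_self]

theorem divisor_add {K : Type*} [Field K] (r s : MonicRatio K) :
    (r + s).divisor = r.divisor + s.divisor := by
  rw [divisor_of_eq (r := r + s) (r.monic_num.mul s.monic_num) (r.monic_denom.mul s.monic_denom)
    (show r.toRatFunc * s.toRatFunc = _ by
      rw [mk'_num_denom r, mk'_num_denom s, map_mul, map_mul, div_mul_div_comm]),
    polyDiv_mul r.monic_num s.monic_num, polyDiv_mul r.monic_denom s.monic_denom, divisor, divisor]
  abel

theorem divisor_neg {K : Type*} [Field K] (r : MonicRatio K) : (-r).divisor = -r.divisor := by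
  rw [divisor_of_eq (r := -r) r.monic_denom r.monic_num
    (show r.toRatFunc⁻¹ = _ by rw [mk'_num_denom r, inv_div]), divisor, neg_sub]

theorem divisor_one {K : Type*} [Field K] : (1 : MonicRatio K).divisor = 1 := by
  rw [divisor_of_eq (r := 1) (monic_X_sub_C 1) monic_one rfl]
  rw [polyDiv, polyDiv, aroots_X_sub_C]
  simp [MonoidAlgebra.one_def]

theorem divisor_mul {K : Type*} [Field K] [CharZero K] (r s : MonicRatio K) :
    (r * s).divisor = r.divisor * s.divisor := by
  rw [divisor_of_eq (r := r * s)
    ((monic_composedProd _ _).mul (monic_composedProd _ _))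
    ((monic_composedProd _ _).mul (monic_composedProd _ _)) rfl,
    polyDiv_mul (monic_composedProd _ _) (monic_composedProd _ _),
    polyDiv_mul (monic_composedProd _ _) (monic_composedProd _ _)]
  simp only [polyDiv_composedProd, divisor]
  ring

/-- The commutative ring `𝓜_K`. -/
noncomputable instance {K : Type*} [Field K] [CharZero K] : CommRing (MonicRatio K) where
  add_assoc a b c := divisor_injective (by simp only [divisor_add, add_assoc])
  zero_add a := divisor_injective (by simp only [divisor_add, divisor_zero, zero_add])
  add_zero a := divisor_injective (by simp only [divisor_add, divisor_zero, add_zero])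
  add_comm a b := divisor_injective (by simp only [divisor_add, add_comm])
  neg_add_cancel a := divisor_injective (by
    simp only [divisor_add, divisor_neg, divisor_zero, neg_add_cancel])
  nsmul := nsmulRec
  zsmul := zsmulRec
  left_distrib a b c := divisor_injective (by simp only [divisor_add, divisor_mul, mul_add])
  right_distrib a b c := divisor_injective (by simp only [divisor_add, divisor_mul, add_mul])
  zero_mul a := divisor_injective (by simp only [divisor_mul, divisor_zero, zero_mul])
  mul_zero a := divisor_injective (by simp only [divisor_mul, divisor_zero, mul_zero])
  mul_assoc a b c := divisor_injective (by simp only [divisor_mul, mul_assoc])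
  one_mul a := divisor_injective (by simp only [divisor_mul, divisor_one, one_mul])
  mul_one a := divisor_injective (by simp only [divisor_mul, divisor_one, mul_one])
  mul_comm a b := divisor_injective (by simp only [divisor_mul, mul_comm])

/-- The map `t_k : 𝓜_K → K`: the additive map with `t_k([x - α]) = α ^ k`, i.e. the sum of the
`k`-th powers of the zeros minus that of the poles, with multiplicity; `0 ^ 0 = 1`, so that `t_0`
is the degree. -/
noncomputable def t {K : Type*} [Field K] [CharZero K] (k : ℕ) (r : MonicRatio K) : K :=
  powerSum k r.num - powerSum k r.denom

/-- The topology of `𝓜_K`: the one induced by `(t_0, t_1, t_2, …) : 𝓜_K → ∏_{k ≥ 0} K`, where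
`K` is discrete and the product carries the product topology. -/
noncomputable instance {K : Type*} [Field K] [CharZero K] : TopologicalSpace (MonicRatio K) :=
  TopologicalSpace.induced (fun r (k : ℕ) => t k r)
    (@Pi.topologicalSpace ℕ (fun _ => K) fun _ => ⊥)

/-- The map `λ_k : 𝓜_K → 𝓜_K` raising all zeros and poles to the `k`-th power:
`[∏ (x - αᵢ) / ∏ (x - βⱼ)] ↦ [∏ (x - αᵢ ^ k) / ∏ (x - βⱼ ^ k)]`. -/
noncomputable def lam {K : Type*} [Field K] [CharZero K] (k : ℕ) (r : MonicRatio K) :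
    MonicRatio K :=
  mk' (rootPow k r.num) (rootPow k r.denom) (monic_rootPow _ _) (monic_rootPow _ _)

/-- The element `[x]`. -/
noncomputable def classX {K : Type*} [Field K] : MonicRatio K :=
  mk' X 1 monic_X monic_one

/-- The element `[1 - x⁻ⁿ]`, for `n ≥ 1`. -/
noncomputable def oneSubInvPow {K : Type*} [Field K] (n : ℕ+) : MonicRatio K :=
  ⟨1 - (RatFunc.X⁻¹) ^ (n : ℕ), X ^ (n : ℕ) - 1, X ^ (n : ℕ),
    monic_X_pow_sub_C 1 n.ne_zero, monic_X_pow _, by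
      have h : (RatFunc.X : K⟮X⟯) ^ (n : ℕ) ≠ 0 := pow_ne_zero _ RatFunc.X_ne_zero
      simp only [map_sub, map_pow, map_one, RatFunc.algebraMap_X, inv_pow]
      rw [sub_div, div_self h, one_div]⟩

end MonicRatio

/-!
Let `φ` be a continuous endomorphism. Each `t_m` is a ring homomorphism, and continuity says that
`t_m ∘ φ` vanishes on the intersection of the kernels of finitely many `t_k`. As the kernel of
`t_m ∘ φ` is prime, it contains one of these kernels, and therefore `t_m ∘ φ = t_{f m}` for some
`f m` (`MonicRatio.exists_t_comp_eq`). Since the `t_k` are jointly injective, `f` determines `φ`.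
Always `f 0 = 0`, because `t_0` is integer valued while `t_j [x - 1/2] = 2⁻ʲ`. It remains to show
that `f m = f 1 * m`: then `φ = λ_k` with `k = f 1` if `f 1 ≥ 1`, and if `f 1 = 0` then every
`t_m ∘ φ` is the degree `t_0`, which vanishes at all `[1 - x⁻ⁿ]`.

The linearity of `f` (`exponent_eq_mul`) comes from the unit `[x - 2]`, whose inverse is
`[x - 1/2]`. The divisor `u = ∑ c_α [α]` of `φ [x - 2]` is a unit of the monoid ring with power
sums `∑ c_α α ^ m = 2 ^ f m`. The roots of unity are a direct factor of the multiplicative group of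
the algebraic closure; let `π` be a projection onto them with `π 2 = 1`, and `W` its kernel, a
torsion-free group. For every `m` the ring homomorphism `[α] ↦ (π α) ^ m [α / π α]` (`twist`) maps
`u` to a unit of the group ring of `W`, that is, to a monomial `x_m [w_m]`
(`MonoidAlgebra.exists_single_of_mul_eq_one`), and `2 ^ f m = x_m w_m ^ m`. Both `x_m` and its
inverse are algebraic integers, and `x_m`, `w_m` are periodic in `m`, say with period `P`; so
`w_m ^ P` is a power of `2`, hence so is `x_m ^ P`, which forces `x_m ^ P = 1`. Applying `π` to
`2 ^ f m = x_m w_m ^ m` gives `x_m = 1`. Finally, for fixed `w` the sum over a period of the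
coefficients at `w` of the twists of `u`, which is the number of `m` with `w_m = w`, is `P` times
the integer `c_w`. So this number is `0` or `P`, all `w_m` are equal to `w_1 = 2 ^ f 1`, and
`2 ^ f m = 2 ^ (m * f 1)`.
-/

/-! ### Units of group rings over torsion-free abelian groups -/

/-- A torsion-free abelian group embeds in the rational vector space `ℚ ⊗ G`, which has the
two-unique-sums property. -/
theorem twoUniqueSums_of_isTorsionFree {G : Type*} [AddCommGroup G] [Module.IsTorsionFree ℤ G] :
    TwoUniqueSums G := by
  let f : G →ₗ[ℤ] TensorProduct ℤ ℚ G :=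
    (LinearMap.rTensor G (Algebra.linearMap ℤ ℚ)).comp (TensorProduct.lid ℤ G).symm.toLinearMap
  have hf : Function.Injective f := by
    have h := Module.Flat.rTensor_preserves_injective_linearMap (M := G) (Algebra.linearMap ℤ ℚ)
      (algebraMap ℤ ℚ).injective_int
    exact h.comp (TensorProduct.lid ℤ G).symm.injective
  exact TwoUniqueSums.of_injective_addHom f.toAddMonoidHom.toAddHom hf inferInstance

theorem twoUniqueProds_of_torsionFree {G : Type*} [CommGroup G]
    (hG : ∀ g : G, IsOfFinOrder g → g = 1) : TwoUniqueProds G := by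
  have : Module.IsTorsionFree ℤ (Additive G) := by
    rw [Submodule.isTorsionFree_iff_torsion_eq_bot, eq_bot_iff]
    rintro g ⟨⟨n, hn⟩, h⟩
    have h1 : (Additive.toMul g) ^ n = 1 := congrArg Additive.toMul h
    have h2 : IsOfFinOrder (Additive.toMul g) :=
      isOfFinOrder_iff_zpow_eq_one.2 ⟨n, nonZeroDivisors.ne_zero hn, h1⟩
    exact congrArg Additive.ofMul (hG _ h2)
  have h : TwoUniqueSums (Additive G) := twoUniqueSums_of_isTorsionFree
  constructor
  intro A B hAB
  exact h.uniqueAdd_of_one_lt_card (A := A) (B := B) hAB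

/-- Over a domain, the units of the group ring of a group with two unique products are the
monomials with unit coefficient: a product of two nonzero elements that are not both monomials has
two nonzero coefficients. -/
theorem MonoidAlgebra.exists_single_of_mul_eq_one {K G : Type*} [CommRing K] [IsDomain K]
    [CommGroup G] [TwoUniqueProds G] {a b : MonoidAlgebra K G} (hab : a * b = 1) :
    ∃ (g : G) (x y : K), x * y = 1 ∧ a = MonoidAlgebra.single g x ∧
      b = MonoidAlgebra.single g⁻¹ y := by
  classical
  have ha : a ≠ 0 := by rintro rfl; simp at hab
  have hb : b ≠ 0 := by rintro rfl; simp at hab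
  have hcard : a.coeff.support.card * b.coeff.support.card ≤ 1 := by
    by_contra! h
    obtain ⟨p, hp, q, hq, hne, hup, huq⟩ := TwoUniqueProds.uniqueMul_of_one_lt_card h
    have key : ∀ p ∈ a.coeff.support ×ˢ b.coeff.support,
        UniqueMul a.coeff.support b.coeff.support p.1 p.2 → p.1 * p.2 = 1 := by
      intro p hp hup
      rw [Finset.mem_product, Finsupp.mem_support_iff, Finsupp.mem_support_iff] at hp
      have h1 := MonoidAlgebra.coeff_mul_mul_of_uniqueMul hup
      rw [hab, MonoidAlgebra.one_def, MonoidAlgebra.coeff_single, Finsupp.single_apply] at h1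
      by_contra h2
      rw [if_neg (Ne.symm h2)] at h1
      exact mul_ne_zero hp.1 hp.2 h1.symm
    rw [Finset.mem_product] at hq
    obtain ⟨h1, h2⟩ := hup hq.1 hq.2
      ((key q (Finset.mem_product.2 hq) huq).trans (key p hp hup).symm)
    exact hne (Prod.ext h1.symm h2.symm)
  have ha' : 0 < a.coeff.support.card := by
    rw [Finset.card_pos, Finsupp.support_nonempty_iff]
    exact fun h => ha (MonoidAlgebra.coeff_eq_zero.1 h)
  have hb' : 0 < b.coeff.support.card := by
    rw [Finset.card_pos, Finsupp.support_nonempty_iff]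
    exact fun h => hb (MonoidAlgebra.coeff_eq_zero.1 h)
  have ha1 : a.coeff.support.card = 1 := by nlinarith
  have hb1 : b.coeff.support.card = 1 := by nlinarith
  obtain ⟨g, x, -, hg⟩ := Finsupp.card_support_eq_one'.1 ha1
  obtain ⟨h, y, -, hh⟩ := Finsupp.card_support_eq_one'.1 hb1
  have ea : a = MonoidAlgebra.single g x := MonoidAlgebra.coeff_injective hg
  have eb : b = MonoidAlgebra.single h y := MonoidAlgebra.coeff_injective hh
  rw [ea, eb, MonoidAlgebra.single_mul_single, MonoidAlgebra.one_def] at hab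
  have h1 := congrArg (fun z => z.coeff 1) hab
  simp only [MonoidAlgebra.coeff_single, Finsupp.single_apply, if_true] at h1
  have hgh : g * h = 1 := by
    by_contra hne
    simp [hne] at h1
  rw [if_pos hgh] at h1
  exact ⟨g, x, y, h1, ea, by rw [eb, eq_inv_of_mul_eq_one_right hgh]⟩

/-! ### Splitting off the roots of unity -/

/-- The roots of unity of an algebraically closed field form a divisible group, so they are a
direct factor of the multiplicative group; the projection can be chosen to kill a given element
`a` of infinite order. -/
theorem exists_torsion_retraction {F : Type*} [Field F] [IsAlgClosed F] [CharZero F] (a : Fˣ)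
    (ha : ¬ IsOfFinOrder a) :
    ∃ π : Fˣ →* Fˣ, (∀ g, IsOfFinOrder (π g)) ∧ (∀ g, IsOfFinOrder g → π g = g) ∧ π a = 1 := by
  let T : Subgroup Fˣ := CommGroup.torsion Fˣ
  have hdiv : ∀ {n : ℕ}, n ≠ 0 → Function.Surjective (fun x : Additive T => n • x) := by
    intro n hn x
    obtain ⟨⟨g, hg⟩, rfl⟩ := Additive.ofMul.surjective x
    obtain ⟨z, hz⟩ := IsAlgClosed.exists_pow_nat_eq (g : F) (Nat.pos_of_ne_zero hn)
    have hz0 : z ≠ 0 := by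
      rintro rfl
      rw [zero_pow hn] at hz
      exact g.ne_zero hz.symm
    have hzg : (Units.mk0 z hz0) ^ n = g := Units.ext (by simpa using hz)
    refine ⟨Additive.ofMul ⟨Units.mk0 z hz0, ?_⟩, ?_⟩
    · have h1 : IsOfFinOrder ((Units.mk0 z hz0) ^ n) := hzg ▸ hg
      exact (isOfFinOrder_pow.1 h1).resolve_right hn
    · exact congrArg Additive.ofMul (Subtype.ext hzg)
  let _ : DivisibleBy (Additive T) ℕ := divisibleByOfSMulRightSurj _ _ hdiv
  let _ : DivisibleBy (Additive T) ℤ := AddGroup.divisibleByIntOfDivisibleByNat _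
  let i : Additive T × ℤ →+ Additive Fˣ :=
    AddMonoidHom.coprod (MonoidHom.toAdditive T.subtype) (zmultiplesHom _ (Additive.ofMul a))
  have hi : Function.Injective i := by
    rw [injective_iff_map_eq_zero]
    rintro ⟨x, n⟩ h
    obtain ⟨⟨g, hg⟩, rfl⟩ := Additive.ofMul.surjective x
    have h1 : g * a ^ n = 1 := congrArg Additive.toMul h
    have h2 : IsOfFinOrder (a ^ n) := by
      rw [eq_inv_of_mul_eq_one_right h1]
      exact IsOfFinOrder.inv hg
    have h3 : n = 0 := by
      obtain ⟨k, hk, h⟩ := isOfFinOrder_iff_zpow_eq_one.1 h2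
      rw [← zpow_mul] at h
      by_contra hn
      exact ha (isOfFinOrder_iff_zpow_eq_one.2 ⟨n * k, mul_ne_zero hn hk, h⟩)
    subst h3
    rw [zpow_zero, mul_one] at h1
    exact Prod.ext (congrArg Additive.ofMul (Subtype.ext h1)) rfl
  obtain ⟨q, hq⟩ := (Module.Baer.of_divisible (Additive T)).extension_property_addMonoidHom i hi
    (AddMonoidHom.fst _ _)
  have hq' : ∀ (g : Fˣ) (hg : g ∈ T) (n : ℤ),
      q (Additive.ofMul (g * a ^ n)) = Additive.ofMul ⟨g, hg⟩ := fun g hg n =>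
    DFunLike.congr_fun hq ((Additive.ofMul ⟨g, hg⟩, n) : Additive T × ℤ)
  refine ⟨T.subtype.comp (MonoidHom.toAdditive.symm q), fun g => ?_, fun g hg => ?_, ?_⟩
  · exact (MonoidHom.toAdditive.symm q g).2
  · have h := hq' g hg 0
    rw [zpow_zero, mul_one] at h
    exact congrArg (fun x : Additive T => ((Additive.toMul x : T) : Fˣ)) h
  · have h := hq' 1 T.one_mem 1
    rw [zpow_one, one_mul] at h
    exact congrArg (fun x : Additive T => ((Additive.toMul x : T) : Fˣ)) h

/-! ### The power sums of a unit -/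

/-- The `k`-th power sum `∑ c_α [α] ↦ ∑ c_α α ^ k` on the monoid ring of a field. -/
noncomputable def evalPow {F : Type*} [Field F] (k : ℕ) : MonoidAlgebra ℤ F →ₐ[ℤ] F :=
  MonoidAlgebra.lift ℤ F F (powMonoidHom k)

theorem evalPow_single {F : Type*} [Field F] (k : ℕ) (a : F) (c : ℤ) :
    evalPow k (MonoidAlgebra.single a c) = c * a ^ k := by
  rw [evalPow, MonoidAlgebra.lift_single, zsmul_eq_mul, powMonoidHom_apply]

/-- The projection `g ↦ g / π g` to the kernel of an idempotent endomorphism `π`. -/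
noncomputable def kerProj {G : Type*} [CommGroup G] (π : G →* G) (hπ : ∀ g, π (π g) = π g) :
    G →* π.ker :=
  MonoidHom.codRestrict (MonoidHom.id G / π) π.ker fun g => by
    rw [MonoidHom.mem_ker, MonoidHom.div_apply, MonoidHom.id_apply, _root_.map_div, hπ, div_self']

theorem coe_kerProj {G : Type*} [CommGroup G] (π : G →* G) (hπ : ∀ g, π (π g) = π g) (g : G) :
    (kerProj π hπ g : G) = g / π g := rfl

open Classical in
/-- The multiplicative map `α ↦ (π α) ^ m [α / π α]`, `0 ↦ 0`, from a field to the group ring of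
the kernel of an idempotent endomorphism `π` of its unit group. -/
noncomputable def twistHom {F : Type*} [Field F] (π : Fˣ →* Fˣ) (hπ : ∀ g, π (π g) = π g)
    (m : ℕ) : F →* MonoidAlgebra F π.ker where
  toFun α := if h : α = 0 then 0 else
    MonoidAlgebra.single (kerProj π hπ (Units.mk0 α h)) ((π (Units.mk0 α h) : F) ^ m)
  map_one' := by
    rw [dif_neg one_ne_zero, Units.mk0_one, map_one, map_one, Units.val_one, one_pow,
      MonoidAlgebra.one_def]
  map_mul' α β := by
    by_cases hα : α = 0
    · simp [hα]
    by_cases hβ : β = 0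
    · simp [hβ]
    rw [dif_neg hα, dif_neg hβ, dif_neg (mul_ne_zero hα hβ), MonoidAlgebra.single_mul_single,
      Units.mk0_mul, map_mul, map_mul, Units.val_mul, mul_pow]

theorem twistHom_zero {F : Type*} [Field F] (π : Fˣ →* Fˣ) (hπ : ∀ g, π (π g) = π g) (m : ℕ) :
    twistHom π hπ m 0 = 0 := dif_pos rfl

theorem twistHom_unit {F : Type*} [Field F] (π : Fˣ →* Fˣ) (hπ : ∀ g, π (π g) = π g) (m : ℕ)
    (g : Fˣ) : twistHom π hπ m g = MonoidAlgebra.single (kerProj π hπ g) ((π g : F) ^ m) := by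
  have h : twistHom π hπ m g = MonoidAlgebra.single (kerProj π hπ (Units.mk0 g g.ne_zero))
      ((π (Units.mk0 g g.ne_zero) : F) ^ m) := dif_neg g.ne_zero
  rwa [Units.mk0_val] at h

/-- The ring homomorphism `∑ c_α [α] ↦ ∑ c_α (π α) ^ m [α / π α]`, the sums on the right being
over `α ≠ 0`. -/
noncomputable def twist {F : Type*} [Field F] (π : Fˣ →* Fˣ) (hπ : ∀ g, π (π g) = π g)
    (m : ℕ) : MonoidAlgebra ℤ F →ₐ[ℤ] MonoidAlgebra F π.ker :=
  MonoidAlgebra.lift ℤ _ _ (twistHom π hπ m)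

theorem coeff_twist {F : Type*} [Field F] (π : Fˣ →* Fˣ) (hπ : ∀ g, π (π g) = π g) (m : ℕ)
    (u : MonoidAlgebra ℤ F) (w : π.ker) :
    (twist π hπ m u).coeff w =
      ∑ α ∈ u.coeff.support, (u.coeff α : F) * (twistHom π hπ m α).coeff w := by
  rw [twist, MonoidAlgebra.lift_apply, Finsupp.sum, MonoidAlgebra.coeff_sum, Finsupp.finsetSum_apply]
  refine Finset.sum_congr rfl fun α _ => ?_
  rw [MonoidAlgebra.coeff_smul, Finsupp.smul_apply, zsmul_eq_mul]

/-- Evaluation of `twist m` at `w ↦ w ^ m` recovers the `m`-th power sum. -/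
theorem lift_twist {F : Type*} [Field F] (π : Fˣ →* Fˣ) (hπ : ∀ g, π (π g) = π g) {m : ℕ}
    (hm : m ≠ 0) (u : MonoidAlgebra ℤ F) :
    MonoidAlgebra.lift F F π.ker ((Units.coeHom F).comp ((powMonoidHom m).comp π.ker.subtype))
      (twist π hπ m u) = evalPow m u := by
  suffices h : ((MonoidAlgebra.lift F F π.ker
      ((Units.coeHom F).comp ((powMonoidHom m).comp π.ker.subtype))).restrictScalars ℤ).comp
      (twist π hπ m) = evalPow m from DFunLike.congr_fun h u
  refine MonoidAlgebra.algHom_ext (fun α => ?_) (Subsingleton.elim _ _)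
  rw [AlgHom.comp_apply, twist, MonoidAlgebra.lift_single, one_smul, evalPow_single,
    AlgHom.restrictScalars_apply]
  by_cases hα : α = 0
  · rw [hα, twistHom_zero, map_zero, zero_pow hm, mul_zero]
  · obtain ⟨g, rfl⟩ : ∃ g : Fˣ, (g : F) = α := ⟨Units.mk0 α hα, rfl⟩
    rw [twistHom_unit, MonoidAlgebra.lift_single]
    have h : (π g) ^ m * (g / π g) ^ m = g ^ m := by rw [← mul_pow, mul_div_cancel]
    have h' := congrArg (Units.val) h
    simpa [coe_kerProj] using h'

theorem isIntegral_of_isOfFinOrder {F : Type*} [Field F] {g : Fˣ} (hg : IsOfFinOrder g) :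
    IsIntegral ℤ (g : F) := by
  obtain ⟨n, hn, h⟩ := isOfFinOrder_iff_pow_eq_one.1 hg
  refine IsIntegral.of_pow hn ?_
  rw [← Units.val_pow_eq_pow_val, h, Units.val_one]
  exact isIntegral_one

theorem isIntegral_coeff_twist {F : Type*} [Field F] (π : Fˣ →* Fˣ) (hπ : ∀ g, π (π g) = π g)
    (hfin : ∀ g, IsOfFinOrder (π g)) (m : ℕ) (u : MonoidAlgebra ℤ F) (w : π.ker) :
    IsIntegral ℤ ((twist π hπ m u).coeff w) := by
  classical
  rw [coeff_twist]
  refine IsIntegral.sum _ fun α _ => IsIntegral.mul (isIntegral_algebraMap (R := ℤ)) ?_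
  by_cases hα : α = 0
  · rw [hα, twistHom_zero]
    exact isIntegral_zero
  · obtain ⟨g, rfl⟩ : ∃ g : Fˣ, (g : F) = α := ⟨Units.mk0 α hα, rfl⟩
    rw [twistHom_unit, MonoidAlgebra.coeff_single, Finsupp.single_apply]
    split_ifs
    · exact (isIntegral_of_isOfFinOrder (hfin g)).pow m
    · exact isIntegral_zero

/-- The projections to the roots of unity of the elements of a finite set have a common exponent. -/
theorem exists_common_exponent {F : Type*} [Field F] (π : Fˣ →* Fˣ)
    (hfin : ∀ g, IsOfFinOrder (π g)) (s : Finset F) :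
    ∃ P : ℕ, 0 < P ∧ ∀ g : Fˣ, (g : F) ∈ s → (π g) ^ P = 1 := by
  classical
  induction s using Finset.induction_on with
  | empty => exact ⟨1, one_pos, fun g hg => absurd hg (Finset.notMem_empty _)⟩
  | insert α s _ ih =>
    obtain ⟨P, hP, h⟩ := ih
    by_cases hα : α = 0
    · refine ⟨P, hP, fun g hg => h g ((Finset.mem_insert.1 hg).resolve_left ?_)⟩
      rw [hα]
      exact g.ne_zero
    · refine ⟨P * orderOf (π (Units.mk0 α hα)), mul_pos hP (hfin _).orderOf_pos, fun g hg => ?_⟩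
      rcases Finset.mem_insert.1 hg with h1 | h1
      · have h2 : g = Units.mk0 α hα := Units.ext h1
        rw [h2, mul_comm, pow_mul, pow_orderOf_eq_one, one_pow]
      · rw [pow_mul, h g h1, one_pow]

theorem twist_add_period {F : Type*} [Field F] (π : Fˣ →* Fˣ) (hπ : ∀ g, π (π g) = π g)
    {u : MonoidAlgebra ℤ F} {P : ℕ} (hP : ∀ g : Fˣ, (g : F) ∈ u.coeff.support → (π g) ^ P = 1)
    (m : ℕ) : twist π hπ (m + P) u = twist π hπ m u := by
  apply MonoidAlgebra.coeff_injective
  ext w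
  rw [coeff_twist, coeff_twist]
  refine Finset.sum_congr rfl fun α hα => ?_
  by_cases h0 : α = 0
  · rw [h0, twistHom_zero, twistHom_zero]
  · obtain ⟨g, rfl⟩ : ∃ g : Fˣ, (g : F) = α := ⟨Units.mk0 α h0, rfl⟩
    rw [twistHom_unit, twistHom_unit, pow_add, ← Units.val_pow_eq_pow_val (π g) P, hP g hα,
      Units.val_one, mul_one]

/-- Over a full period the coefficients of `twist m u` at `w` add up to `P` times the coefficient
of `u` at `w`, since the sum of the powers of a nontrivial root of unity vanishes. -/
theorem exists_sum_coeff_twist {F : Type*} [Field F] (π : Fˣ →* Fˣ)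
    (hπ : ∀ g, π (π g) = π g) {u : MonoidAlgebra ℤ F} {P : ℕ}
    (hP : ∀ g : Fˣ, (g : F) ∈ u.coeff.support → (π g) ^ P = 1) (w : π.ker) :
    ∃ z : ℤ, ∑ i ∈ Finset.range P, (twist π hπ (i + 1) u).coeff w = P * z := by
  classical
  have key : ∀ α ∈ u.coeff.support, ∃ z : ℤ,
      ∑ i ∈ Finset.range P, (twistHom π hπ (i + 1) α).coeff w = P * z := by
    intro α hα
    by_cases h0 : α = 0
    · refine ⟨0, ?_⟩
      simp [h0, twistHom_zero]
    · obtain ⟨g, rfl⟩ : ∃ g : Fˣ, (g : F) = α := ⟨Units.mk0 α h0, rfl⟩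
      simp only [twistHom_unit, MonoidAlgebra.coeff_single, Finsupp.single_apply]
      by_cases hw : kerProj π hπ g = w
      · simp only [if_pos hw]
        by_cases h1 : π g = 1
        · exact ⟨1, by simp [h1]⟩
        · refine ⟨0, ?_⟩
          have h2 : (π g : F) ≠ 1 := fun h => h1 (Units.ext h)
          have h3 := geom_sum_eq h2 P
          rw [← Units.val_pow_eq_pow_val, hP g hα, Units.val_one, sub_self, zero_div] at h3
          simp only [pow_succ, ← Finset.sum_mul, h3, zero_mul, Int.cast_zero, mul_zero]
      · exact ⟨0, by simp [hw]⟩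
  choose! z hz using key
  refine ⟨∑ α ∈ u.coeff.support, u.coeff α * z α, ?_⟩
  simp only [coeff_twist]
  rw [Finset.sum_comm, Int.cast_sum, Finset.mul_sum]
  refine Finset.sum_congr rfl fun α hα => ?_
  rw [← Finset.mul_sum, hz α hα, Int.cast_mul]
  ring

theorem le_of_isIntegral_of_mul_two_pow {F : Type*} [Field F] [CharZero F] {x : F}
    (hx : IsIntegral ℤ x) {a b : ℕ} (h : x * 2 ^ b = 2 ^ a) : b ≤ a := by
  by_contra! hab
  obtain ⟨c, rfl⟩ : ∃ c, b = a + (c + 1) := ⟨b - a - 1, by omega⟩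
  have h1 : x * 2 ^ (c + 1) = 1 := by
    have h2 : (2 : F) ^ a ≠ 0 := pow_ne_zero _ two_ne_zero
    apply mul_right_cancel₀ h2
    rw [one_mul]
    refine Eq.trans ?_ h
    ring
  have hx' : x = algebraMap ℚ F ((2 ^ (c + 1))⁻¹) := by
    rw [map_inv₀, map_pow, map_ofNat]
    exact eq_inv_of_mul_eq_one_left h1
  rw [hx', isIntegral_algebraMap_iff (algebraMap ℚ F).injective] at hx
  obtain ⟨z, hz⟩ := IsIntegrallyClosed.isIntegral_iff.1 hx
  have h3 : (z : ℚ) * 2 ^ (c + 1) = 1 := by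
    rw [show (z : ℚ) = (2 ^ (c + 1))⁻¹ from hz]
    exact inv_mul_cancel₀ (by positivity)
  have h4 : z * 2 ^ (c + 1) = 1 := by exact_mod_cast h3
  have h5 : (2 : ℤ) ∣ 1 := ⟨z * 2 ^ c, by rw [← h4]; ring⟩
  norm_num at h5

/-- If all power sums of positive order of a unit are powers of two, then the exponents are
proportional to the order. -/
theorem exponent_eq_mul {F : Type*} [Field F] [IsAlgClosed F] [CharZero F]
    {u v : MonoidAlgebra ℤ F} (huv : u * v = 1) (f : ℕ → ℕ)
    (hf : ∀ m, m ≠ 0 → evalPow m u = 2 ^ f m) (m : ℕ) (hm : m ≠ 0) : f m = m * f 1 := by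
  classical
  have hpow : Function.Injective fun n : ℕ => (2 : F) ^ n := by
    intro a b h
    have h' : ((2 ^ a : ℕ) : F) = ((2 ^ b : ℕ) : F) := by push_cast; exact h
    exact Nat.pow_right_injective le_rfl (Nat.cast_injective h')
  let two : Fˣ := Units.mk0 2 two_ne_zero
  have htwo : ¬ IsOfFinOrder two := by
    intro h
    obtain ⟨n, hn, h⟩ := isOfFinOrder_iff_pow_eq_one.1 h
    have h1 : (2 : F) ^ n = 2 ^ 0 := by
      have := congrArg Units.val h
      simpa [two] using this
    exact hn.ne' (hpow h1)
  obtain ⟨π, hfin, hfix, hπ2⟩ := exists_torsion_retraction two htwo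
  have hπ : ∀ g, π (π g) = π g := fun g => hfix _ (hfin g)
  have _ : TwoUniqueProds π.ker := twoUniqueProds_of_torsionFree fun g hg => by
    have h1 : IsOfFinOrder (g : Fˣ) := π.ker.subtype.isOfFinOrder hg
    exact Subtype.ext ((hfix _ h1).symm.trans g.2)
  have hmon : ∀ m : ℕ, ∃ (w : π.ker) (x y : F), x * y = 1 ∧
      twist π hπ m u = MonoidAlgebra.single w x ∧ twist π hπ m v = MonoidAlgebra.single w⁻¹ y :=
    fun m => MonoidAlgebra.exists_single_of_mul_eq_one (by rw [← map_mul, huv, map_one])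
  choose w x y hxy hu hv using hmon
  have hx0 : ∀ m, x m ≠ 0 := fun m => left_ne_zero_of_mul_eq_one (hxy m)
  have hxint : ∀ m, IsIntegral ℤ (x m) := fun m => by
    have h := isIntegral_coeff_twist π hπ hfin m u (w m)
    rwa [hu, MonoidAlgebra.coeff_single, Finsupp.single_eq_same] at h
  have hyint : ∀ m, IsIntegral ℤ (y m) := fun m => by
    have h := isIntegral_coeff_twist π hπ hfin m v (w m)⁻¹
    rwa [hv, MonoidAlgebra.coeff_single, Finsupp.single_eq_same] at h
  have heval : ∀ m, m ≠ 0 → x m * ((w m : Fˣ) : F) ^ m = 2 ^ f m := by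
    intro m hm
    rw [← hf m hm, ← lift_twist π hπ hm, hu, MonoidAlgebra.lift_single]
    simp
  obtain ⟨P₀, hP₀, hexp⟩ := exists_common_exponent π hfin u.coeff.support
  have hper : ∀ m, w (m + P₀) = w m ∧ x (m + P₀) = x m := by
    intro m
    have h := twist_add_period π hπ hexp m
    rw [hu, hu] at h
    have h' := congrArg MonoidAlgebra.coeff h
    rw [MonoidAlgebra.coeff_single, MonoidAlgebra.coeff_single, Finsupp.single_eq_single_iff] at h'
    rcases h' with h' | h'
    · exact h'
    · exact absurd h'.1 (hx0 _)
  -- By periodicity `w m ^ P₀` is a power of two, hence so is `x m ^ P₀`; being an integral unit,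
  -- it is `1`.
  have hxfin : ∀ m, m ≠ 0 → x m ^ P₀ = 1 := by
    intro m hm
    have h1 := heval m hm
    have h2 := heval (m + P₀) (by omega)
    rw [(hper m).1, (hper m).2, pow_add, ← mul_assoc, h1] at h2
    set W : F := ((w m : Fˣ) : F)
    have h3 : x m ^ P₀ * 2 ^ (m * f (m + P₀)) = 2 ^ (m * f m + P₀ * f m) := by
      rw [mul_comm m (f (m + P₀)), pow_mul, ← h2, mul_pow, ← pow_mul, ← pow_mul, mul_comm P₀ m,
        pow_mul W, pow_add, mul_comm P₀ (f m), pow_mul 2 (f m) P₀, ← h1, mul_comm (f m) m]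
      ring
    have h4 : y m ^ P₀ * 2 ^ (m * f m + P₀ * f m) = 2 ^ (m * f (m + P₀)) := by
      rw [← h3, ← mul_assoc, ← mul_pow, mul_comm (y m), hxy, one_pow, one_mul]
    have h5 := le_antisymm (le_of_isIntegral_of_mul_two_pow ((hxint m).pow P₀) h3)
      (le_of_isIntegral_of_mul_two_pow ((hyint m).pow P₀) h4)
    rw [h5] at h3
    exact mul_right_cancel₀ (pow_ne_zero _ two_ne_zero) (h3.trans (one_mul _).symm)
  have hx1 : ∀ m, m ≠ 0 → x m = 1 := by
    intro m hm
    let ξ : Fˣ := Units.mk0 (x m) (hx0 m)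
    have h1 : ξ * (w m : Fˣ) ^ m = two ^ f m := Units.ext (by simpa [ξ, two] using heval m hm)
    have h2 : IsOfFinOrder ξ := isOfFinOrder_iff_pow_eq_one.2
      ⟨P₀, hP₀, Units.ext (by simpa [ξ] using hxfin m hm)⟩
    have h3 := congrArg π h1
    rw [map_mul, map_pow, map_pow, hπ2, one_pow, MonoidHom.mem_ker.1 (w m).2, one_pow, mul_one,
      hfix ξ h2] at h3
    exact congrArg Units.val h3
  -- Among the orders up to the multiple `P₀ * m` of the period, the number of those with the same
  -- `w` as order `1` is a positive multiple of `P₀ * m`, so it is all of them.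
  obtain ⟨z, hz⟩ := exists_sum_coeff_twist π hπ (P := P₀ * m)
    (fun g hg => by rw [pow_mul, hexp g hg, one_pow]) (w 1)
  have hcount : ∑ i ∈ Finset.range (P₀ * m), (twist π hπ (i + 1) u).coeff (w 1) =
      (((Finset.range (P₀ * m)).filter fun i => w (i + 1) = w 1).card : F) := by
    rw [Finset.card_filter, Nat.cast_sum]
    refine Finset.sum_congr rfl fun i _ => ?_
    rw [hu, MonoidAlgebra.coeff_single, Finsupp.single_apply, hx1 _ i.succ_ne_zero]
    split_ifs <;> simp
  rw [hcount] at hz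
  set N := ((Finset.range (P₀ * m)).filter fun i => w (i + 1) = w 1).card
  have hPm : 0 < P₀ * m := Nat.mul_pos hP₀ (Nat.pos_of_ne_zero hm)
  have hz' : (N : ℤ) = (P₀ * m : ℕ) * z := by exact_mod_cast hz
  have hNpos : 0 < N := Finset.card_pos.2 ⟨0, Finset.mem_filter.2 ⟨Finset.mem_range.2 hPm, rfl⟩⟩
  have hNle : P₀ * m ≤ N := by
    apply Nat.le_of_dvd hNpos
    have : ((P₀ * m : ℕ) : ℤ) ∣ (N : ℤ) := ⟨z, hz'⟩
    exact_mod_cast this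
  have hall : (Finset.range (P₀ * m)).filter (fun i => w (i + 1) = w 1) = Finset.range (P₀ * m) :=
    Finset.eq_of_subset_of_card_le (Finset.filter_subset _ _) (by rwa [Finset.card_range])
  have hmem : m - 1 ∈ (Finset.range (P₀ * m)).filter (fun i => w (i + 1) = w 1) := by
    rw [hall, Finset.mem_range]
    have : m ≤ P₀ * m := Nat.le_mul_of_pos_left m hP₀
    omega
  have hwm : w m = w 1 := by
    have := (Finset.mem_filter.1 hmem).2
    rwa [Nat.sub_add_cancel (Nat.pos_of_ne_zero hm)] at this
  have h1 := heval 1 one_ne_zero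
  have h2 := heval m hm
  rw [hx1 _ one_ne_zero, one_mul, pow_one] at h1
  rw [hx1 _ hm, one_mul, hwm, h1, ← pow_mul, mul_comm] at h2
  exact (hpow h2).symm

/-! ### The maps `t_k` are jointly injective ring homomorphisms -/

/-- The power sums determine an element of the monoid ring, by linear independence of the
characters `k ↦ α ^ k`. -/
theorem eq_zero_of_evalPow_eq_zero {F : Type*} [Field F] [CharZero F]
    {u : MonoidAlgebra ℤ F} (h : ∀ k, evalPow k u = 0) : u = 0 := by
  have hinj : Function.Injective (powersHom F) := (powersHom F).injective
  have hli := (linearIndependent_monoidHom (Multiplicative ℕ) F).comp (powersHom F) hinj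
  rw [linearIndependent_iff'] at hli
  have h1 := hli u.coeff.support (fun α => (u.coeff α : F)) (by
    ext k
    have hk := h k.toAdd
    rw [evalPow, MonoidAlgebra.lift_apply, Finsupp.sum] at hk
    rw [Finset.sum_apply, Pi.zero_apply, ← hk]
    refine Finset.sum_congr rfl fun α _ => ?_
    rw [Pi.smul_apply, smul_eq_mul, zsmul_eq_mul]
    rfl)
  apply MonoidAlgebra.coeff_eq_zero.1
  ext α
  by_contra hα
  have h2 := h1 α (Finsupp.mem_support_iff.2 hα)
  exact hα (by exact_mod_cast h2)

namespace MonicRatio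

theorem algebraMap_powerSum {K : Type*} [Field K] [CharZero K] (k : ℕ) (f : K[X]) :
    algebraMap K (AlgebraicClosure K) (powerSum k f) = evalPow k (polyDiv f) := by
  rw [powerSum, (exists_powerSum k f).choose_spec, polyDiv, map_multiset_sum, Multiset.map_map]
  congr 1
  refine Multiset.map_congr rfl fun a _ => ?_
  rw [Function.comp_apply, MonoidAlgebra.of_apply, evalPow_single, Int.cast_one, one_mul]

theorem algebraMap_t {K : Type*} [Field K] [CharZero K] (k : ℕ) (r : MonicRatio K) :
    algebraMap K (AlgebraicClosure K) (t k r) = evalPow k r.divisor := by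
  rw [t, map_sub, algebraMap_powerSum, algebraMap_powerSum, divisor, map_sub]

/-- `t_k` as a ring homomorphism. -/
noncomputable def tHom {K : Type*} [Field K] [CharZero K] (k : ℕ) : MonicRatio K →+* K where
  toFun := t k
  map_zero' := (algebraMap K (AlgebraicClosure K)).injective (by
    rw [algebraMap_t, divisor_zero, map_zero, map_zero])
  map_one' := (algebraMap K (AlgebraicClosure K)).injective (by
    rw [algebraMap_t, divisor_one, map_one, map_one])
  map_add' r s := (algebraMap K (AlgebraicClosure K)).injective (by
    rw [map_add, algebraMap_t, algebraMap_t, algebraMap_t, divisor_add, map_add])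
  map_mul' r s := (algebraMap K (AlgebraicClosure K)).injective (by
    rw [map_mul, algebraMap_t, algebraMap_t, algebraMap_t, divisor_mul, map_mul])

theorem tHom_apply {K : Type*} [Field K] [CharZero K] (k : ℕ) (r : MonicRatio K) :
    tHom k r = t k r := rfl

theorem ext_t {K : Type*} [Field K] [CharZero K] {r s : MonicRatio K}
    (h : ∀ k, t k r = t k s) : r = s := by
  apply divisor_injective
  rw [← sub_eq_zero]
  apply eq_zero_of_evalPow_eq_zero
  intro k
  rw [map_sub, ← algebraMap_t, ← algebraMap_t, h, sub_self]

theorem divisor_mk' {K : Type*} [Field K] (f g : K[X]) (hf : f.Monic) (hg : g.Monic) :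
    (mk' f g hf hg).divisor = polyDiv f - polyDiv g := divisor_of_eq hf hg rfl

/-- `t_0` is the degree. -/
theorem exists_int_t_zero {K : Type*} [Field K] [CharZero K] (r : MonicRatio K) :
    ∃ c : ℤ, t 0 r = c := by
  refine ⟨r.divisor.coeff.sum fun _ c => c, (algebraMap K (AlgebraicClosure K)).injective ?_⟩
  rw [algebraMap_t, evalPow, MonoidAlgebra.lift_apply, map_intCast, Finsupp.sum, Finsupp.sum,
    Int.cast_sum]
  exact Finset.sum_congr rfl fun α _ => by simp

theorem t_zero_oneSubInvPow {K : Type*} [Field K] [CharZero K] (n : ℕ+) :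
    t 0 (oneSubInvPow n : MonicRatio K) = 0 := by
  have key : ∀ f : K[X], evalPow 0 (polyDiv f) = (f.natDegree : AlgebraicClosure K) := by
    intro f
    rw [polyDiv, map_multiset_sum, Multiset.map_map]
    have h : ∀ a : AlgebraicClosure K, (⇑(evalPow (F := AlgebraicClosure K) 0) ∘
        fun a => MonoidAlgebra.of ℤ (AlgebraicClosure K) a) a = 1 := fun a => by
      rw [Function.comp_apply, MonoidAlgebra.of_apply, evalPow_single, pow_zero, Int.cast_one,
        one_mul]
    rw [Multiset.map_congr rfl fun a _ => h a, Multiset.map_const', Multiset.sum_replicate,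
      nsmul_one, aroots_def, ← (IsAlgClosed.splits _).natDegree_eq_card_roots, natDegree_map]
  apply (algebraMap K (AlgebraicClosure K)).injective
  rw [algebraMap_t, map_zero]
  obtain ⟨hf, hg⟩ : (X ^ (n : ℕ) - 1 : K[X]).Monic ∧ (X ^ (n : ℕ) : K[X]).Monic :=
    ⟨monic_X_pow_sub_C 1 n.ne_zero, monic_X_pow _⟩
  have h : (oneSubInvPow n : MonicRatio K) = mk' _ _ hf hg := by
    apply MonicRatio.ext
    have h : (RatFunc.X : K⟮X⟯) ^ (n : ℕ) ≠ 0 := pow_ne_zero _ RatFunc.X_ne_zero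
    simp only [oneSubInvPow, mk', map_sub, map_pow, map_one, RatFunc.algebraMap_X, inv_pow]
    rw [sub_div, div_self h, one_div]
  have h1 : (X ^ (n : ℕ) - 1 : K[X]).natDegree = n := natDegree_X_pow_sub_C (r := (1 : K))
  rw [h, divisor_mk', map_sub, key, key, h1, natDegree_X_pow, sub_self]

theorem t_lam {K : Type*} [Field K] [CharZero K] (m k : ℕ) (r : MonicRatio K) :
    t m (lam k r) = t (k * m) r := by
  have key : ∀ f : K[X], evalPow m (polyDiv (rootPow k f)) = evalPow (k * m) (polyDiv f) := by
    intro f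
    rw [polyDiv, aroots_def, rootPow, (exists_rootPow k f).choose_spec.2,
      roots_multiset_prod_X_sub_C, polyDiv]
    simp only [map_multiset_sum, Multiset.map_map, Function.comp_def, MonoidAlgebra.of_apply,
      evalPow_single, pow_mul]
  apply (algebraMap K (AlgebraicClosure K)).injective
  rw [algebraMap_t, algebraMap_t, lam, divisor_mk', map_sub, key, key, divisor, map_sub]

/-- The class `[x - q]`. -/
noncomputable def point {K : Type*} [Field K] (q : K) : MonicRatio K :=
  mk' (X - C q) 1 (monic_X_sub_C q) monic_one

theorem t_point {K : Type*} [Field K] [CharZero K] (k : ℕ) (q : K) :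
    t k (point q) = q ^ k := by
  apply (algebraMap K (AlgebraicClosure K)).injective
  rw [algebraMap_t, point, divisor_mk', polyDiv, polyDiv, aroots_X_sub_C, map_sub]
  simp [evalPow_single]

theorem point_mul_point {K : Type*} [Field K] [CharZero K] (p q : K) :
    point p * point q = point (p * q) := by
  refine ext_t fun k => ?_
  rw [← tHom_apply, map_mul, tHom_apply, tHom_apply, t_point, t_point, t_point, mul_pow]

theorem point_one {K : Type*} [Field K] : point (1 : K) = 1 := rfl

/-! ### Composing the maps `t_k` with a continuous endomorphism -/

theorem exists_bound_of_continuous {K : Type*} [Field K] [CharZero K]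
    (φ : MonicRatio K →+* MonicRatio K) (hφ : Continuous φ) (m : ℕ) :
    ∃ N : ℕ, ∀ r, (∀ k < N, t k r = 0) → t m (φ r) = 0 := by
  let _ : TopologicalSpace K := ⊥
  have _ : DiscreteTopology K := ⟨rfl⟩
  have hind : Topology.IsInducing (fun (r : MonicRatio K) (k : ℕ) => t k r) := ⟨rfl⟩
  have hcont : Continuous fun r => t m (φ r) :=
    (continuous_apply m).comp (hind.continuous.comp hφ)
  have hopen : IsOpen {r | t m (φ r) = 0} := (isOpen_discrete ({0} : Set K)).preimage hcont
  obtain ⟨V, hV, hpre⟩ := hind.isOpen_iff.1 hopen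
  have ht0 : ∀ k, t k (0 : MonicRatio K) = 0 := fun k => map_zero (tHom k)
  have h0 : (fun k => t k (0 : MonicRatio K)) ∈ V := by
    have : (0 : MonicRatio K) ∈ {r | t m (φ r) = 0} := by
      rw [Set.mem_ofPred_eq, map_zero, ht0]
    rwa [← hpre] at this
  obtain ⟨I, U, hU, hsub⟩ := isOpen_pi_iff.1 hV _ h0
  obtain ⟨N, hN⟩ := I.exists_nat_subset_range
  refine ⟨N, fun r hr => ?_⟩
  have h1 : r ∈ {r | t m (φ r) = 0} := by
    rw [← hpre]
    refine hsub fun k hk => ?_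
    have hrk : t k r = t k 0 := (hr k (Finset.mem_range.1 (hN hk))).trans (ht0 k).symm
    have hmem : t k r ∈ U k := by
      rw [hrk]
      exact (hU k hk).2
    exact hmem
  exact h1

/-- The kernel of the ring homomorphism `t_m ∘ φ` is a prime ideal containing a finite
intersection of kernels of maps `t_k`, hence containing one of them, say that of `t_i`. Applied to
`b r - a` with `t_i r = a / b`, this gives `t_m (φ r) = a / b`. -/
theorem exists_t_comp_eq (φ : MonicRatio ℚ →+* MonicRatio ℚ) (hφ : Continuous φ) (m : ℕ) :
    ∃ i, ∀ r, t m (φ r) = t i r := by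
  obtain ⟨N, hN⟩ := exists_bound_of_continuous φ hφ m
  have hle : (Finset.range N).inf (fun k => RingHom.ker (tHom (K := ℚ) k)) ≤
      RingHom.ker ((tHom m).comp φ) := by
    intro r hr
    rw [Submodule.mem_finsetInf] at hr
    exact hN r fun k hk => hr k (Finset.mem_range.2 hk)
  obtain ⟨i, -, hi⟩ := (RingHom.ker_isPrime ((tHom m).comp φ)).inf_le'.1 hle
  refine ⟨i, fun r => ?_⟩
  have h1 : ((t i r).den : MonicRatio ℚ) * r - ((t i r).num : MonicRatio ℚ) ∈
      RingHom.ker (tHom (K := ℚ) i) := by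
    rw [RingHom.mem_ker, map_sub, map_mul, map_natCast, map_intCast, tHom_apply,
      Rat.den_mul_eq_num, sub_self]
  have h2 := hi h1
  rw [RingHom.mem_ker, map_sub, map_mul, map_natCast, map_intCast, sub_eq_zero,
    RingHom.comp_apply, tHom_apply, ← Rat.den_mul_eq_num] at h2
  exact mul_left_cancel₀ (Nat.cast_ne_zero.2 (t i r).den_nz) h2

end MonicRatio

/-! ### Classification of the continuous endomorphisms -/

theorem mainTheorem2 (φ : MonicRatio ℚ →+* MonicRatio ℚ) (hφ : Continuous φ) :
    (∃ k j : ℕ, 1 ≤ k ∧ ∀ r : MonicRatio ℚ, ∃ c : ℤ,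
      (c : ℚ) = MonicRatio.t j r - MonicRatio.t 0 r ∧
        φ r = MonicRatio.lam k r + c • MonicRatio.classX) ∨
    {n : ℕ+ | φ (MonicRatio.oneSubInvPow n) ≠ 0}.Finite := by
  choose f hf using MonicRatio.exists_t_comp_eq φ hφ
  -- `t_0` takes integer values only, in particular at `φ [x - 1/2]`.
  have hf0 : f 0 = 0 := by
    obtain ⟨c, hc⟩ := MonicRatio.exists_int_t_zero (φ (MonicRatio.point 2⁻¹))
    rw [hf, MonicRatio.t_point] at hc
    have h := le_of_isIntegral_of_mul_two_pow (F := ℚ) (x := c) (a := 0) (b := f 0)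
      (isIntegral_algebraMap (R := ℤ)) (by
        rw [← hc, ← mul_pow, inv_mul_cancel₀ two_ne_zero, one_pow, pow_zero])
    omega
  have huv : (φ (MonicRatio.point 2)).divisor * (φ (MonicRatio.point 2⁻¹)).divisor = 1 := by
    rw [← MonicRatio.divisor_mul, ← map_mul, MonicRatio.point_mul_point,
      mul_inv_cancel₀ two_ne_zero, MonicRatio.point_one, map_one, MonicRatio.divisor_one]
  have hlin : ∀ m, f m = f 1 * m := by
    intro m
    by_cases hm : m = 0
    · rw [hm, hf0, mul_zero]
    · rw [mul_comm]
      refine exponent_eq_mul huv f (fun m _ => ?_) m hm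
      rw [← MonicRatio.algebraMap_t, hf, MonicRatio.t_point, map_pow, map_ofNat]
  rcases Nat.eq_zero_or_pos (f 1) with h1 | h1
  · right
    have h : ∀ n : ℕ+, φ (MonicRatio.oneSubInvPow n) = 0 := by
      refine fun n => MonicRatio.ext_t fun m => ?_
      rw [hf, hlin, h1, zero_mul, MonicRatio.t_zero_oneSubInvPow]
      exact (map_zero (MonicRatio.tHom m)).symm
    simp [h]
  · left
    refine ⟨f 1, 0, h1, fun r => ⟨0, by rw [Int.cast_zero, sub_self], ?_⟩⟩
    rw [zero_smul, add_zero]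
    refine MonicRatio.ext_t fun m => ?_
    rw [hf, hlin, MonicRatio.t_lam]
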